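/- All Hilbert spaces are complex. Products of unbounded operators are taken on their natural domains, $D(RT)=\{x\in D(T): Tx\in D(R)\}$, and $\overline{T}$ denotes the closure of a closable operator $T$. There is a Hilbert space $K$ and a densely defined symmetric operator $S$ in $K$ such that $SS^*$ is densely defined and $(SS^*)^*\neq\overline{S}S^*$. More precisely, the following hold. (1) Let $E,F$ be Hilbert spaces and let $T:E\supseteq D(T)\to F$ be a densely defined closable operator such that $TT^*$ is densely defined and $(TT^*)^*\neq\overline{T}T^*$. On $F\oplus E$ let \[S=\begin{pmatrix}0&T\\T^*&0\end{pmatrix},\qquad D(S)=D(T^*)\oplus D(T),\] that is, $S(x,y)=(Ty,T^*x)$. Then $S$ is densely defined, symmetric (hence closable), \[S^*=\begin{pmatrix}0&\overline{T}\\T^*&0\end{pmatrix},\quad SS^*=\begin{pmatrix}TT^*&0\\0&T^*\overline{T}\end{pmatrix},\quad \overline{S}S^*=\begin{pmatrix}\overline{T}T^*&0\\0&T^*\overline{T}\end{pmatrix},\] the operator $SS^*$ is densely defined, $T^*\overline{T}$ is self-adjoint, \[(SS^*)^*=\begin{pmatrix}(TT^*)^*&0\\0&T^*\overline{T}\end{pmatrix},\]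 and $(SS^*)^*\neq\overline{S}S^*$. (2) Such operators $T$ are obtained as follows. Let $A$ be a densely defined positive operator in a Hilbert space $H$ that is not essentially self-adjoint and whose range is dense in $H$. Let $H_A$ be the completion of $\operatorname{ran}A$ for the inner product $\langle Ax,Ay\rangle_A=\langle Ax,y\rangle$ $(x,y\in D(A))$, and let $T:H_A\supseteq\operatorname{ran}A\to H$, $T(Ax)=Ax$. Then $T$ is densely defined and closable, $TT^*$ is densely defined, and $(TT^*)^*\neq\overline{T}T^*$. (3) There exist a Hilbert space $H$ and an operator $A$ in $H$ as in (2). -/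

import Mathlib

open scoped LinearPMap

noncomputable section

namespace UnboundedOp

/-- The product `R T` of two partially defined operators, on its natural domain
`{x ∈ D(T) : T x ∈ D(R)}`. -/
def mul {E F G : Type*} [AddCommGroup E] [Module ℂ E] [AddCommGroup F] [Module ℂ F]
    [AddCommGroup G] [Module ℂ G] (R : F →ₗ.[ℂ] G) (T : E →ₗ.[ℂ] F) : E →ₗ.[ℂ] G where
  domain := (R.domain.comap T.toFun).map T.domain.subtype
  toFun := R.toFun ∘ₗ LinearMap.codRestrict R.domain
    (T.toFun ∘ₗ Submodule.inclusion (Submodule.map_subtype_le _ _))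
    (by
      rintro ⟨x, hx⟩
      obtain ⟨y, hy, rfl⟩ := hx
      exact hy)

theorem mem_mul_domain {E F G : Type*} [AddCommGroup E] [Module ℂ E] [AddCommGroup F]
    [Module ℂ F] [AddCommGroup G] [Module ℂ G] (R : F →ₗ.[ℂ] G) (T : E →ₗ.[ℂ] F) (x : E) :
    x ∈ (mul R T).domain ↔ ∃ h : x ∈ T.domain, T ⟨x, h⟩ ∈ R.domain := by
  simp [mul]

theorem mul_apply {E F G : Type*} [AddCommGroup E] [Module ℂ E] [AddCommGroup F]
    [Module ℂ F] [AddCommGroup G] [Module ℂ G] (R : F →ₗ.[ℂ] G) (T : E →ₗ.[ℂ] F) (x : E)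
    (hx : x ∈ (mul R T).domain) (h : x ∈ T.domain) (h' : T ⟨x, h⟩ ∈ R.domain) :
    mul R T ⟨x, hx⟩ = R ⟨T ⟨x, h⟩, h'⟩ := rfl

/-- The operator matrix `[[P, Q], [R, V]]` from the Hilbert direct sum `X ⊕ Y` to `X' ⊕ Y'`, on
its natural domain `(D(P) ∩ D(R)) ⊕ (D(Q) ∩ D(V))`; it sends `(x, y)` to
`(P x + Q y, R x + V y)`. The entry `0` is the zero operator, defined everywhere. -/
def opMatrix {X Y X' Y' : Type*} [AddCommGroup X] [Module ℂ X] [AddCommGroup Y] [Module ℂ Y]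
    [AddCommGroup X'] [Module ℂ X'] [AddCommGroup Y'] [Module ℂ Y']
    (P : X →ₗ.[ℂ] X') (Q : Y →ₗ.[ℂ] X') (R : X →ₗ.[ℂ] Y') (V : Y →ₗ.[ℂ] Y') :
    WithLp 2 (X × Y) →ₗ.[ℂ] WithLp 2 (X' × Y') where
  domain := ((P.domain ⊓ R.domain).prod (Q.domain ⊓ V.domain)).comap
    (WithLp.linearEquiv 2 ℂ (X × Y)).toLinearMap
  toFun :=
    { toFun := fun z => WithLp.toLp 2
        (P ⟨z.1.fst, z.2.1.1⟩ + Q ⟨z.1.snd, z.2.2.1⟩,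
          R ⟨z.1.fst, z.2.1.2⟩ + V ⟨z.1.snd, z.2.2.2⟩)
      map_add' := by
        rintro ⟨z, hz⟩ ⟨w, hw⟩
        rw [← WithLp.toLp_add, Prod.mk_add_mk]
        congr 2
        · exact (congrArg₂ (· + ·) (P.map_add ⟨z.fst, hz.1.1⟩ ⟨w.fst, hw.1.1⟩)
            (Q.map_add ⟨z.snd, hz.2.1⟩ ⟨w.snd, hw.2.1⟩)).trans (add_add_add_comm _ _ _ _)
        · exact (congrArg₂ (· + ·) (R.map_add ⟨z.fst, hz.1.2⟩ ⟨w.fst, hw.1.2⟩)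
            (V.map_add ⟨z.snd, hz.2.2⟩ ⟨w.snd, hw.2.2⟩)).trans (add_add_add_comm _ _ _ _)
      map_smul' := by
        rintro c ⟨z, hz⟩
        rw [RingHom.id_apply, ← WithLp.toLp_smul, Prod.smul_mk]
        congr 2
        · exact (congrArg₂ (· + ·) (P.map_smul c ⟨z.fst, hz.1.1⟩)
            (Q.map_smul c ⟨z.snd, hz.2.1⟩)).trans (smul_add _ _ _).symm
        · exact (congrArg₂ (· + ·) (R.map_smul c ⟨z.fst, hz.1.2⟩)
            (V.map_smul c ⟨z.snd, hz.2.2⟩)).trans (smul_add _ _ _).symm }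

section

variable {H : Type*} [NormedAddCommGroup H] [InnerProductSpace ℂ H]

/-- `⟨S x, y⟩ = ⟨x, S y⟩` for all `x, y ∈ D(S)`. -/
def IsSymm (S : H →ₗ.[ℂ] H) : Prop :=
  ∀ x y : S.domain, inner ℂ (S x) (y : H) = inner ℂ (x : H) (S y)

/-- `A` is densely defined, symmetric, and `⟨A x, x⟩ ≥ 0` for all `x ∈ D(A)`. -/
structure IsDensePositive (A : H →ₗ.[ℂ] H) : Prop where
  dense : Dense (A.domain : Set H)
  symm : IsSymm A
  nonneg : ∀ x : A.domain, 0 ≤ (inner ℂ (A x) (x : H)).re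

/-- The range of a densely defined positive operator `A`, as a vector space (with no norm: the
one that it gets below is not the norm of `H`). -/
def EnergyRange (A : H →ₗ.[ℂ] H) (_hA : IsDensePositive A) : Type _ :=
  LinearMap.range A.toFun

variable {A : H →ₗ.[ℂ] H} {hA : IsDensePositive A}

instance : AddCommGroup (EnergyRange A hA) :=
  inferInstanceAs (AddCommGroup (LinearMap.range A.toFun))

instance : Module ℂ (EnergyRange A hA) :=
  inferInstanceAs (Module ℂ (LinearMap.range A.toFun))

namespace EnergyRange

/-- The inclusion of `ran A` in `H`. -/
def incl (A : H →ₗ.[ℂ] H) (hA : IsDensePositive A) : EnergyRange A hA →ₗ[ℂ] H :=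
  (LinearMap.range A.toFun).subtype

/-- A preimage of `u ∈ ran A` under `A`. -/
def preim (u : EnergyRange A hA) : A.domain := u.2.choose

theorem apply_preim (u : EnergyRange A hA) : A (preim u) = incl A hA u := u.2.choose_spec

/-- `A x` as an element of `EnergyRange A hA`. -/
def mk (A : H →ₗ.[ℂ] H) (hA : IsDensePositive A) (x : A.domain) : EnergyRange A hA :=
  ⟨A x, x, rfl⟩

/-- The form `⟨A x, A y⟩_A = ⟨A x, y⟩` on `ran A`. -/
def form (u v : EnergyRange A hA) : ℂ := inner ℂ (incl A hA u) (preim v : H)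

theorem form_eq (u v : EnergyRange A hA) (y : A.domain) (hy : A y = incl A hA v) :
    form u v = inner ℂ (incl A hA u) (y : H) := by
  rw [form, ← apply_preim u, hA.symm, hA.symm, apply_preim v, hy]

theorem form_mk_mk (x y : A.domain) :
    form (mk A hA x) (mk A hA y) = inner ℂ (A x) (y : H) :=
  form_eq _ _ y rfl

/-- `⟨·, ·⟩_A` as a positive semidefinite Hermitian form. -/
@[reducible]
def preCore (A : H →ₗ.[ℂ] H) (hA : IsDensePositive A) :
    PreInnerProductSpace.Core ℂ (EnergyRange A hA) where
  inner := form
  conj_inner_symm u v := by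
    rw [form, inner_conj_symm, ← apply_preim v, form, ← apply_preim u, hA.symm]
  re_inner_nonneg u := by
    rw [form, ← apply_preim u]
    exact hA.nonneg _
  add_left u v w := by simp only [form, map_add, inner_add_left]
  smul_left u v r := by simp only [form, map_smul, inner_smul_left]

/-- `⟨·, ·⟩_A` is an inner product on `ran A`. -/
@[reducible]
def core (A : H →ₗ.[ℂ] H) (hA : IsDensePositive A) :
    InnerProductSpace.Core ℂ (EnergyRange A hA) where
  __ := preCore A hA
  definite u hu := by
    have h0 : ∀ y : A.domain, inner ℂ (incl A hA u) (y : H) = 0 := by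
      intro y
      let _ := preCore A hA
      have h := InnerProductSpace.Core.inner_mul_inner_self_le (𝕜 := ℂ) u (mk A hA y)
      have hu' : (preCore A hA).inner u u = 0 := hu
      rw [InnerProductSpace.Core.norm_inner_symm (mk A hA y) u] at h
      change ‖form u (mk A hA y)‖ * ‖form u (mk A hA y)‖ ≤
        RCLike.re ((preCore A hA).inner u u) * _ at h
      rw [hu', map_zero, zero_mul, form_eq u _ y rfl] at h
      have := mul_self_eq_zero.mp (le_antisymm h (mul_self_nonneg _))
      exact norm_eq_zero.mp this
    have h1 : incl A hA u = 0 := hA.dense.eq_zero_of_inner_left ℂ fun v hv => h0 ⟨v, hv⟩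
    exact Subtype.ext h1

instance : NormedAddCommGroup (EnergyRange A hA) :=
  letI := core A hA
  InnerProductSpace.Core.toNormedAddCommGroup (𝕜 := ℂ)

instance : InnerProductSpace ℂ (EnergyRange A hA) :=
  InnerProductSpace.ofCore (core A hA).toCore

theorem inner_mk_mk (x y : A.domain) :
    inner ℂ (mk A hA x) (mk A hA y) = inner ℂ (A x) (y : H) :=
  form_mk_mk x y

end EnergyRange

/-- The Hilbert space completion `H_A` of `(ran A, ⟨·, ·⟩_A)`. -/
abbrev EnergySpace (A : H →ₗ.[ℂ] H) (hA : IsDensePositive A) : Type _ :=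
  UniformSpace.Completion (EnergyRange A hA)

/-- The canonical embedding operator `T : H_A ⊇ ran A → H`, `T (A x) = A x`. -/
def energyEmbedding (A : H →ₗ.[ℂ] H) (hA : IsDensePositive A) :
    EnergySpace A hA →ₗ.[ℂ] H where
  domain := LinearMap.range
    (UniformSpace.Completion.toComplₗᵢ (𝕜 := ℂ) (E := EnergyRange A hA)).toLinearMap
  toFun := EnergyRange.incl A hA ∘ₗ
    (LinearEquiv.ofInjective
      (UniformSpace.Completion.toComplₗᵢ (𝕜 := ℂ) (E := EnergyRange A hA)).toLinearMap
      (UniformSpace.Completion.toComplₗᵢ (𝕜 := ℂ) (E := EnergyRange A hA)).injective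
      ).symm.toLinearMap

theorem coe_mem_energyEmbedding_domain (u : EnergyRange A hA) :
    (u : EnergySpace A hA) ∈ (energyEmbedding A hA).domain :=
  ⟨u, rfl⟩

theorem energyEmbedding_apply (x : A.domain) :
    energyEmbedding A hA ⟨(EnergyRange.mk A hA x : EnergySpace A hA),
      coe_mem_energyEmbedding_domain _⟩ = A x := by
  have : (LinearEquiv.ofInjective
      (UniformSpace.Completion.toComplₗᵢ (𝕜 := ℂ) (E := EnergyRange A hA)).toLinearMap
      (UniformSpace.Completion.toComplₗᵢ (𝕜 := ℂ) (E := EnergyRange A hA)).injective).symm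
      ⟨(EnergyRange.mk A hA x : EnergySpace A hA), coe_mem_energyEmbedding_domain _⟩
      = EnergyRange.mk A hA x := by
    rw [LinearEquiv.symm_apply_eq]
    rfl
  exact congrArg (EnergyRange.incl A hA) this

end

section

variable {E F : Type*} [NormedAddCommGroup E] [InnerProductSpace ℂ E] [CompleteSpace E]
  [NormedAddCommGroup F] [InnerProductSpace ℂ F] [CompleteSpace F]

/-- `T` is densely defined and closable, `T T*` is densely defined, and `(T T*)* ≠ T̄ T*`. -/
structure IsCounterexample (T : E →ₗ.[ℂ] F) : Prop where
  dense : Dense (T.domain : Set E)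
  closable : T.IsClosable
  dense_mul : Dense ((mul T T†).domain : Set F)
  ne : (mul T T†)† ≠ mul T.closure T†

end

end UnboundedOp

end

/-! Both counterexamples come from von Neumann's theorem. For closable densely defined `T`, `T̄ T*`
equals `T** T*` and is therefore self-adjoint. For the embedding `T` of the energy space, `T T*` is
`A` itself (`energyEmbedding_mul_adjoint`), so `(T T*)* = T̄ T*` would make `A*` self-adjoint; then
`A* = A** = Ā`, and `A` would be essentially self-adjoint.

Passing from `T` to `S` is matrix calculus on graphs: adjoints and products of off-diagonal matrices
are computed entrywise, and the first diagonal entry of `S S*` carries the discrepancy.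

A suitable `A` is a restriction of `C⁻¹ - 1` for a diagonal contraction `C` on `ℓ²`: the domain is
cut down to `C (w^⊥)`, which is still dense because `w` is not in the range of `C`. Then `A* w =
-w`, which is incompatible with positivity if `Ā` is self-adjoint. -/

noncomputable section

namespace UnboundedOp

/-! ### Products and operator matrices in terms of graphs -/

section Graph

theorem mem_graph_mul {E F G : Type*} [AddCommGroup E] [Module ℂ E] [AddCommGroup F] [Module ℂ F]
    [AddCommGroup G] [Module ℂ G] (R : F →ₗ.[ℂ] G) (T : E →ₗ.[ℂ] F) (x : E) (z : G) :
    (x, z) ∈ (mul R T).graph ↔ ∃ y, (x, y) ∈ T.graph ∧ (y, z) ∈ R.graph := by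
  simp only [LinearPMap.mem_graph_iff]
  constructor
  · rintro ⟨⟨x', hx⟩, rfl, rfl⟩
    obtain ⟨h, h'⟩ := (mem_mul_domain R T x').1 hx
    exact ⟨T ⟨x', h⟩, ⟨⟨x', h⟩, rfl, rfl⟩, ⟨_, h'⟩, rfl, rfl⟩
  · rintro ⟨y, ⟨x', rfl, rfl⟩, ⟨y', hy, rfl⟩⟩
    have h' : T ⟨x', x'.2⟩ ∈ R.domain := hy ▸ y'.2
    refine ⟨⟨x', (mem_mul_domain R T _).2 ⟨x'.2, h'⟩⟩, rfl, ?_⟩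
    rw [mul_apply R T _ _ x'.2 h']
    congr 1
    exact Subtype.ext hy.symm

variable {X Y X' Y' : Type*} [AddCommGroup X] [Module ℂ X] [AddCommGroup Y] [Module ℂ Y]
    [AddCommGroup X'] [Module ℂ X'] [AddCommGroup Y'] [Module ℂ Y']

theorem mem_graph_opMatrix_offDiag (Q : Y →ₗ.[ℂ] X') (R : X →ₗ.[ℂ] Y')
    (z : WithLp 2 (X × Y)) (w : WithLp 2 (X' × Y')) :
    (z, w) ∈ (opMatrix 0 Q R 0).graph ↔ (z.snd, w.fst) ∈ Q.graph ∧ (z.fst, w.snd) ∈ R.graph := by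
  simp only [LinearPMap.mem_graph_iff]
  constructor
  · rintro ⟨⟨z', hz⟩, rfl, rfl⟩
    exact ⟨⟨⟨_, hz.2.1⟩, rfl, (zero_add _).symm⟩, ⟨_, hz.1.2⟩, rfl, (add_zero _).symm⟩
  · rintro ⟨⟨y, hy, hy'⟩, ⟨x, hx, hx'⟩⟩
    refine ⟨⟨z, ⟨trivial, ?_⟩, ⟨?_, trivial⟩⟩, rfl, ?_⟩
    · exact (congrArg (· ∈ R.domain) hx).mp x.2
    · exact (congrArg (· ∈ Q.domain) hy).mp y.2
    refine (WithLp.ofLp_injective 2) (Prod.ext ?_ ?_)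
    · refine (zero_add _).trans (Eq.trans ?_ hy')
      exact congrArg Q (Subtype.ext hy.symm)
    · refine (add_zero _).trans (Eq.trans ?_ hx')
      exact congrArg R (Subtype.ext hx.symm)

theorem mem_graph_opMatrix_diag (P : X →ₗ.[ℂ] X') (V : Y →ₗ.[ℂ] Y')
    (z : WithLp 2 (X × Y)) (w : WithLp 2 (X' × Y')) :
    (z, w) ∈ (opMatrix P 0 0 V).graph ↔ (z.fst, w.fst) ∈ P.graph ∧ (z.snd, w.snd) ∈ V.graph := by
  simp only [LinearPMap.mem_graph_iff]
  constructor
  · rintro ⟨⟨z', hz⟩, rfl, rfl⟩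
    exact ⟨⟨⟨_, hz.1.1⟩, rfl, (add_zero _).symm⟩, ⟨_, hz.2.2⟩, rfl, (zero_add _).symm⟩
  · rintro ⟨⟨x, hx, hx'⟩, ⟨y, hy, hy'⟩⟩
    refine ⟨⟨z, ⟨?_, trivial⟩, ⟨trivial, ?_⟩⟩, rfl, ?_⟩
    · exact (congrArg (· ∈ P.domain) hx).mp x.2
    · exact (congrArg (· ∈ V.domain) hy).mp y.2
    refine (WithLp.ofLp_injective 2) (Prod.ext ?_ ?_)
    · refine (add_zero _).trans (Eq.trans ?_ hx')
      exact congrArg P (Subtype.ext hx.symm)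
    · refine (zero_add _).trans (Eq.trans ?_ hy')
      exact congrArg V (Subtype.ext hy.symm)

/-- An off-diagonal matrix exchanges the two summands, so two of them in succession preserve each
summand. -/
theorem mul_opMatrix_offDiag {X'' Y'' : Type*} [AddCommGroup X''] [Module ℂ X'']
    [AddCommGroup Y''] [Module ℂ Y''] (Q' : Y' →ₗ.[ℂ] X'') (R' : X' →ₗ.[ℂ] Y'')
    (Q : Y →ₗ.[ℂ] X') (R : X →ₗ.[ℂ] Y') :
    mul (opMatrix 0 Q' R' 0) (opMatrix 0 Q R 0) = opMatrix (mul Q' R) 0 0 (mul R' Q) := by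
  refine LinearPMap.eq_of_eq_graph (SetLike.ext ?_)
  rintro ⟨z, w⟩
  simp only [mem_graph_mul, mem_graph_opMatrix_offDiag, mem_graph_opMatrix_diag]
  constructor
  · rintro ⟨y, ⟨h1, h2⟩, h3, h4⟩
    exact ⟨⟨_, h2, h3⟩, _, h1, h4⟩
  · rintro ⟨⟨a, h1, h2⟩, b, h3, h4⟩
    exact ⟨WithLp.toLp 2 (b, a), ⟨h3, h1⟩, h2, h4⟩

theorem opMatrix_diag_injective_left {P P' : X →ₗ.[ℂ] X'} {V V' : Y →ₗ.[ℂ] Y'}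
    (h : opMatrix P 0 0 V = opMatrix P' 0 0 V') : P = P' := by
  refine LinearPMap.eq_of_eq_graph (SetLike.ext ?_)
  rintro ⟨x, x'⟩
  have key (P V) : (x, x') ∈ P.graph ↔
      (WithLp.toLp 2 (x, (0 : Y)), WithLp.toLp 2 (x', (0 : Y'))) ∈ (opMatrix P 0 0 V).graph := by
    rw [mem_graph_opMatrix_diag]
    exact (and_iff_left V.graph.zero_mem).symm
  rw [key P V, key P' V', h]

end Graph

/-! ### Adjoints, closures and von Neumann's theorem -/

section Adjoint

variable {E F : Type*} [NormedAddCommGroup E] [InnerProductSpace ℂ E]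
  [NormedAddCommGroup F] [InnerProductSpace ℂ F]

theorem mem_graph_adjoint [CompleteSpace E] {T : E →ₗ.[ℂ] F}
    (hT : Dense (T.domain : Set E)) (y : F) (w : E) :
    (y, w) ∈ T†.graph ↔ ∀ a b, (a, b) ∈ T.graph → inner ℂ b y = inner ℂ a w := by
  rw [LinearPMap.adjoint_graph_eq_graph_adjoint hT, Submodule.mem_adjoint_iff]
  simp only [sub_eq_zero]

theorem dense_domain_of_graph {T : E →ₗ.[ℂ] F} [CompleteSpace E]
    (h : ∀ v : E, (∀ a b, (a, b) ∈ T.graph → inner ℂ a v = 0) → v = 0) :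
    Dense (T.domain : Set E) := by
  rw [Submodule.dense_iff_topologicalClosure_eq_top, Submodule.topologicalClosure_eq_top_iff,
    Submodule.eq_bot_iff]
  intro v hv
  refine h v fun a b hab => (Submodule.mem_orthogonal _ _).1 hv a ?_
  exact LinearPMap.mem_domain_of_mem_graph hab

theorem eq_zero_of_dense_domain {T : E →ₗ.[ℂ] F} (hT : Dense (T.domain : Set E)) {v : E}
    (h : ∀ a b, (a, b) ∈ T.graph → inner ℂ a v = 0) : v = 0 :=
  hT.eq_zero_of_inner_right ℂ fun a ha => h a _ (T.mem_graph ⟨a, ha⟩)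

variable [CompleteSpace E] [CompleteSpace F]

/-- The closure of `g` is its double orthogonal complement, and `(w, -y)` is orthogonal to `g`
exactly when `(y, w)` satisfies the adjoint relation. The argument runs in `WithLp 2`, since `E × F`
has the sup norm; the topology is the same. -/
theorem mem_closure_of_mem_adjoint_adjoint (g : Submodule ℂ (E × F)) {v : E × F}
    (h : ∀ y w, (∀ a b, (a, b) ∈ g → inner ℂ b y = inner ℂ a w) →
      inner ℂ w v.1 = inner ℂ y v.2) : v ∈ g.topologicalClosure := by
  let K : Submodule ℂ (WithLp 2 (E × F)) :=
    g.comap (WithLp.linearEquiv 2 ℂ (E × F)).toLinearMap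
  have hv : WithLp.toLp 2 v ∈ K.topologicalClosure := by
    rw [← Submodule.orthogonal_orthogonal_eq_closure, Submodule.mem_orthogonal]
    intro u hu
    rw [Submodule.mem_orthogonal] at hu
    have := h (-u.snd) u.fst fun a b hab => by
      have h1 := hu (WithLp.toLp 2 (a, b)) hab
      rw [WithLp.prod_inner_apply] at h1
      rw [inner_neg_right]
      exact (eq_neg_of_add_eq_zero_left h1).symm
    rw [WithLp.prod_inner_apply]
    rw [inner_neg_left] at this
    exact add_eq_zero_iff_eq_neg.2 this
  exact map_mem_closure (WithLp.prod_continuous_ofLp 2 E F) hv fun u hu => hu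

omit [CompleteSpace F] in
theorem adjoint_closure {T : E →ₗ.[ℂ] F} (hT : Dense (T.domain : Set E)) (hc : T.IsClosable) :
    T.closure† = T† := by
  have hT' : Dense (T.closure.domain : Set E) := hT.mono T.le_closure.1
  refine LinearPMap.eq_of_eq_graph (SetLike.ext ?_)
  rintro ⟨y, w⟩
  rw [mem_graph_adjoint hT', mem_graph_adjoint hT]
  refine ⟨fun h a b hab => h a b (LinearPMap.le_graph_of_le T.le_closure hab), fun h a b hab => ?_⟩
  rw [← hc.graph_closure_eq_closure_graph] at hab
  have hcl : IsClosed {p : E × F | inner ℂ p.2 y = inner ℂ p.1 w} :=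
    isClosed_eq (by fun_prop) (by fun_prop)
  exact closure_minimal (fun p hp => h p.1 p.2 hp) hcl hab

/-- If `v` is orthogonal to `D(T*)`, then `(0, v)` satisfies the relation defining `T**`, so it lies
in the closed graph of `T`; closability forces `v = 0`. -/
theorem dense_adjoint_domain {T : E →ₗ.[ℂ] F} (hT : Dense (T.domain : Set E))
    (hc : T.IsClosable) : Dense (T†.domain : Set F) := by
  refine dense_domain_of_graph fun v hv => ?_
  have h : ((0 : E), v) ∈ T.closure.graph := by
    rw [← hc.graph_closure_eq_closure_graph]
    refine mem_closure_of_mem_adjoint_adjoint _ fun y w h => ?_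
    rw [inner_zero_right]
    exact (hv y w ((mem_graph_adjoint hT y w).2 h)).symm
  exact LinearPMap.graph_fst_eq_zero_snd _ h rfl

theorem adjoint_adjoint {T : E →ₗ.[ℂ] F} (hT : Dense (T.domain : Set E))
    (hc : T.IsClosable) : T†† = T.closure := by
  refine LinearPMap.eq_of_eq_graph (le_antisymm ?_ ?_)
  · rintro ⟨y, w⟩ h
    rw [mem_graph_adjoint (dense_adjoint_domain hT hc)] at h
    rw [← hc.graph_closure_eq_closure_graph]
    exact mem_closure_of_mem_adjoint_adjoint _ fun a b hab =>
      h a b ((mem_graph_adjoint hT a b).2 hab)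
  · rintro ⟨y, w⟩ h
    rw [mem_graph_adjoint (dense_adjoint_domain hT hc)]
    intro a b hab
    rw [← adjoint_closure hT hc, mem_graph_adjoint (hT.mono T.le_closure.1)] at hab
    rw [← inner_conj_symm, ← hab y w h, inner_conj_symm]

theorem isClosable_of_dense_adjoint_domain {T : E →ₗ.[ℂ] F} (hT : Dense (T.domain : Set E))
    (hT' : Dense (T†.domain : Set F)) : T.IsClosable :=
  (LinearPMap.adjoint_isClosed hT').isClosable.leIsClosable
    ((LinearPMap.adjoint_isFormalAdjoint hT).le_adjoint hT')

/-- A symmetric operator `N` with `1 + N` onto is self-adjoint. -/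
theorem isSelfAdjoint_of_surjective {N : E →ₗ.[ℂ] E}
    (hN : ∀ a b a' b', (a, b) ∈ N.graph → (a', b') ∈ N.graph → inner ℂ b a' = inner ℂ a b')
    (hs : ∀ x, ∃ u v, (u, v) ∈ N.graph ∧ u + v = x) : IsSelfAdjoint N := by
  have hd : Dense (N.domain : Set E) := by
    refine dense_domain_of_graph fun x hx => ?_
    obtain ⟨u, v, huv, rfl⟩ := hs x
    -- With `x = u + N u` orthogonal to the domain and `u = a + N a`, symmetry gives `0 = ⟨a, u + N
    -- u⟩ = ⟨a + N a, u⟩ = ‖u‖²`.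
    obtain ⟨a, b, hab, h⟩ := hs u
    have h1 := hx a b hab
    rw [inner_add_right, ← hN a b u v hab huv, ← inner_add_left, h, inner_self_eq_zero] at h1
    subst h1
    rw [LinearPMap.graph_fst_eq_zero_snd _ huv rfl, add_zero]
  rw [LinearPMap.isSelfAdjoint_def]
  refine LinearPMap.eq_of_eq_graph (le_antisymm ?_ ?_)
  · rintro ⟨y, w⟩ h
    rw [mem_graph_adjoint hd] at h
    obtain ⟨u, v, huv, huv'⟩ := hs (y + w)
    -- The vector `y - u` satisfies `(1 + N*)(y - u) = 0`, so it is orthogonal to the range of `1 +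
    -- N`, hence to itself.
    obtain ⟨a, b, hab, h'⟩ := hs (y - u)
    have h1 := h a b hab
    have h2 := hN a b u v hab huv
    have h3 : y = u := by
      rw [← sub_eq_zero, ← inner_self_eq_zero (𝕜 := ℂ)]
      nth_rw 1 [← h']
      rw [inner_add_left, inner_sub_right, inner_sub_right, h1, h2, sub_add_sub_comm,
        ← inner_add_right, ← inner_add_right, huv', sub_self]
    subst h3
    rwa [← add_left_cancel huv']
  · rintro ⟨y, w⟩ h
    rw [mem_graph_adjoint hd]
    exact fun a b hab => hN a b y w hab h

/-- Von Neumann's theorem: `T* T` is self-adjoint for a closed densely defined `T`. -/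
theorem isSelfAdjoint_adjoint_mul_self {T : E →ₗ.[ℂ] F} (hT : Dense (T.domain : Set E))
    (hc : T.IsClosed) : IsSelfAdjoint (mul T† T) := by
  refine isSelfAdjoint_of_surjective ?_ fun x => ?_
  · intro a b a' b' h h'
    obtain ⟨c, h1, h2⟩ := (mem_graph_mul _ _ _ _).1 h
    obtain ⟨c', h1', h2'⟩ := (mem_graph_mul _ _ _ _).1 h'
    rw [mem_graph_adjoint hT] at h2 h2'
    rw [← h2' a c h1, ← inner_conj_symm, ← h2 a' c' h1', inner_conj_symm]
  · let K : Submodule ℂ (WithLp 2 (E × F)) :=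
      T.graph.comap (WithLp.linearEquiv 2 ℂ (E × F)).toLinearMap
    have hK : IsClosed (K : Set (WithLp 2 (E × F))) :=
      IsClosed.preimage (WithLp.prod_continuous_ofLp 2 E F) hc
    have : CompleteSpace K := hK.completeSpace_coe
    -- Projecting `(x, 0)` onto the graph gives `p = (u, T u)`, and orthogonality of `q = (x - u, -T
    -- u)` to the graph says `T* T u = x - u`.
    obtain ⟨p, hp, q, hq, hpq⟩ := K.exists_add_mem_mem_orthogonal (WithLp.toLp 2 (x, (0 : F)))
    have h1 : x = p.fst + q.fst := congrArg (fun z : WithLp 2 (E × F) => z.fst) hpq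
    have h2 : (0 : F) = p.snd + q.snd := congrArg (fun z : WithLp 2 (E × F) => z.snd) hpq
    refine ⟨p.fst, q.fst, (mem_graph_mul _ _ _ _).2 ⟨p.snd, hp, ?_⟩, h1.symm⟩
    rw [mem_graph_adjoint hT]
    intro a b hab
    have h3 := (Submodule.mem_orthogonal _ _).1 hq (WithLp.toLp 2 (a, b)) hab
    rw [WithLp.prod_inner_apply] at h3
    rw [eq_neg_of_add_eq_zero_left h2.symm, inner_neg_right]
    exact (eq_neg_of_add_eq_zero_left h3).symm

variable {E' F' : Type*} [NormedAddCommGroup E'] [InnerProductSpace ℂ E']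
  [NormedAddCommGroup F'] [InnerProductSpace ℂ F']

theorem dense_opMatrix_offDiag_domain {Q : F →ₗ.[ℂ] E'} {R : E →ₗ.[ℂ] F'}
    (hQ : Dense (Q.domain : Set F)) (hR : Dense (R.domain : Set E)) :
    Dense ((opMatrix 0 Q R 0).domain : Set (WithLp 2 (E × F))) := by
  refine dense_domain_of_graph fun v hv => WithLp.ofLp_injective 2 (Prod.ext ?_ ?_)
  · refine eq_zero_of_dense_domain hR fun a b hab => ?_
    have := hv (WithLp.toLp 2 (a, 0)) (WithLp.toLp 2 (0, b))
      ((mem_graph_opMatrix_offDiag _ _ _ _).2 ⟨Q.graph.zero_mem, hab⟩)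
    simpa [WithLp.prod_inner_apply] using this
  · refine eq_zero_of_dense_domain hQ fun a b hab => ?_
    have := hv (WithLp.toLp 2 (0, a)) (WithLp.toLp 2 (b, 0))
      ((mem_graph_opMatrix_offDiag _ _ _ _).2 ⟨hab, R.graph.zero_mem⟩)
    simpa [WithLp.prod_inner_apply] using this

theorem dense_opMatrix_diag_domain {P : E →ₗ.[ℂ] E'} {V : F →ₗ.[ℂ] F'}
    (hP : Dense (P.domain : Set E)) (hV : Dense (V.domain : Set F)) :
    Dense ((opMatrix P 0 0 V).domain : Set (WithLp 2 (E × F))) := by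
  refine dense_domain_of_graph fun v hv => WithLp.ofLp_injective 2 (Prod.ext ?_ ?_)
  · refine eq_zero_of_dense_domain hP fun a b hab => ?_
    have := hv (WithLp.toLp 2 (a, 0)) (WithLp.toLp 2 (b, 0))
      ((mem_graph_opMatrix_diag _ _ _ _).2 ⟨hab, V.graph.zero_mem⟩)
    simpa [WithLp.prod_inner_apply] using this
  · refine eq_zero_of_dense_domain hV fun a b hab => ?_
    have := hv (WithLp.toLp 2 (0, a)) (WithLp.toLp 2 (0, b))
      ((mem_graph_opMatrix_diag _ _ _ _).2 ⟨P.graph.zero_mem, hab⟩)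
    simpa [WithLp.prod_inner_apply] using this

/-- Testing the adjoint relation on vectors supported in one summand separates it into the relations
for `Q` and `R`. -/
theorem adjoint_opMatrix_offDiag {Q : F →ₗ.[ℂ] E'} {R : E →ₗ.[ℂ] F'}
    (hQ : Dense (Q.domain : Set F)) (hR : Dense (R.domain : Set E)) :
    (opMatrix 0 Q R 0)† = opMatrix 0 R† Q† 0 := by
  refine LinearPMap.eq_of_eq_graph (SetLike.ext ?_)
  rintro ⟨z, w⟩
  rw [mem_graph_adjoint (dense_opMatrix_offDiag_domain hQ hR), mem_graph_opMatrix_offDiag,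
    mem_graph_adjoint hQ, mem_graph_adjoint hR]
  constructor
  · intro h
    refine ⟨fun a b hab => ?_, fun a b hab => ?_⟩
    · have := h (WithLp.toLp 2 (a, 0)) (WithLp.toLp 2 (0, b))
        ((mem_graph_opMatrix_offDiag _ _ _ _).2 ⟨Q.graph.zero_mem, hab⟩)
      simpa [WithLp.prod_inner_apply] using this
    · have := h (WithLp.toLp 2 (0, a)) (WithLp.toLp 2 (b, 0))
        ((mem_graph_opMatrix_offDiag _ _ _ _).2 ⟨hab, R.graph.zero_mem⟩)
      simpa [WithLp.prod_inner_apply] using this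
  · rintro ⟨h1, h2⟩ a b hab
    obtain ⟨h3, h4⟩ := (mem_graph_opMatrix_offDiag _ _ _ _).1 hab
    rw [WithLp.prod_inner_apply, WithLp.prod_inner_apply]
    exact (congrArg₂ (· + ·) (h2 _ _ h3) (h1 _ _ h4)).trans (add_comm _ _)

theorem adjoint_opMatrix_diag {P : E →ₗ.[ℂ] E'} {V : F →ₗ.[ℂ] F'}
    (hP : Dense (P.domain : Set E)) (hV : Dense (V.domain : Set F)) :
    (opMatrix P 0 0 V)† = opMatrix P† 0 0 V† := by
  refine LinearPMap.eq_of_eq_graph (SetLike.ext ?_)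
  rintro ⟨z, w⟩
  rw [mem_graph_adjoint (dense_opMatrix_diag_domain hP hV), mem_graph_opMatrix_diag,
    mem_graph_adjoint hP, mem_graph_adjoint hV]
  constructor
  · intro h
    refine ⟨fun a b hab => ?_, fun a b hab => ?_⟩
    · have := h (WithLp.toLp 2 (a, 0)) (WithLp.toLp 2 (b, 0))
        ((mem_graph_opMatrix_diag _ _ _ _).2 ⟨hab, V.graph.zero_mem⟩)
      simpa [WithLp.prod_inner_apply] using this
    · have := h (WithLp.toLp 2 (0, a)) (WithLp.toLp 2 (0, b))
        ((mem_graph_opMatrix_diag _ _ _ _).2 ⟨P.graph.zero_mem, hab⟩)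
      simpa [WithLp.prod_inner_apply] using this
  · rintro ⟨h1, h2⟩ a b hab
    obtain ⟨h3, h4⟩ := (mem_graph_opMatrix_diag _ _ _ _).1 hab
    rw [WithLp.prod_inner_apply, WithLp.prod_inner_apply]
    exact congrArg₂ (· + ·) (h1 _ _ h3) (h2 _ _ h4)

end Adjoint

/-! ### Symmetric operators -/

section Symmetric

variable {H : Type*} [NormedAddCommGroup H] [InnerProductSpace ℂ H]

variable [CompleteSpace H]

theorem IsSymm.le_adjoint {A : H →ₗ.[ℂ] H} (hA : IsSymm A) (hd : Dense (A.domain : Set H)) :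
    A ≤ A† :=
  LinearPMap.IsFormalAdjoint.le_adjoint hd hA

theorem isSymm_of_le_adjoint {A : H →ₗ.[ℂ] H} (hd : Dense (A.domain : Set H)) (h : A ≤ A†) :
    IsSymm A := by
  intro x y
  have hx := LinearPMap.le_graph_of_le h (A.mem_graph x)
  rw [mem_graph_adjoint hd] at hx
  rw [← inner_conj_symm, ← hx _ _ (A.mem_graph y), inner_conj_symm]

theorem IsSymm.isClosable {A : H →ₗ.[ℂ] H} (hA : IsSymm A) (hd : Dense (A.domain : Set H)) :
    A.IsClosable :=
  (LinearPMap.adjoint_isClosed hd).isClosable.leIsClosable (hA.le_adjoint hd)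

end Symmetric

/-! ### From `T` to the symmetric operator matrix -/

section Matrix

variable {E F : Type*} [NormedAddCommGroup E] [InnerProductSpace ℂ E] [CompleteSpace E]
  [NormedAddCommGroup F] [InnerProductSpace ℂ F] [CompleteSpace F] {T : E →ₗ.[ℂ] F}

omit [CompleteSpace E] [CompleteSpace F] in
theorem dense_closure_domain (hT : Dense (T.domain : Set E)) :
    Dense (T.closure.domain : Set E) :=
  hT.mono T.le_closure.1

theorem isSelfAdjoint_adjoint_mul_closure (hT : Dense (T.domain : Set E)) (hc : T.IsClosable) :
    IsSelfAdjoint (mul T† T.closure) := by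
  rw [← adjoint_closure hT hc]
  exact isSelfAdjoint_adjoint_mul_self (dense_closure_domain hT) hc.closure_isClosed

theorem isSelfAdjoint_closure_mul_adjoint (hT : Dense (T.domain : Set E)) (hc : T.IsClosable) :
    IsSelfAdjoint (mul T.closure T†) := by
  rw [← adjoint_adjoint hT hc]
  exact isSelfAdjoint_adjoint_mul_self (dense_adjoint_domain hT hc) (LinearPMap.adjoint_isClosed hT)

theorem dense_opMatrix_adjoint (hT : Dense (T.domain : Set E)) (hc : T.IsClosable) :
    Dense ((opMatrix 0 T T† 0).domain : Set (WithLp 2 (F × E))) :=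
  dense_opMatrix_offDiag_domain hT (dense_adjoint_domain hT hc)

theorem adjoint_opMatrix_adjoint (hT : Dense (T.domain : Set E)) (hc : T.IsClosable) :
    (opMatrix 0 T T† 0)† = opMatrix 0 T.closure T† 0 := by
  rw [adjoint_opMatrix_offDiag hT (dense_adjoint_domain hT hc), adjoint_adjoint hT hc]

theorem isSymm_opMatrix_adjoint (hT : Dense (T.domain : Set E)) (hc : T.IsClosable) :
    IsSymm (opMatrix 0 T T† 0) := by
  refine isSymm_of_le_adjoint (dense_opMatrix_adjoint hT hc) (LinearPMap.le_of_le_graph ?_)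
  rw [adjoint_opMatrix_adjoint hT hc]
  rintro ⟨z, w⟩ h
  rw [mem_graph_opMatrix_offDiag] at h ⊢
  exact ⟨LinearPMap.le_graph_of_le T.le_closure h.1, h.2⟩

/-- The closure is the double adjoint, which the matrix calculus computes. -/
theorem closure_opMatrix_adjoint (hT : Dense (T.domain : Set E)) (hc : T.IsClosable) :
    (opMatrix 0 T T† 0).closure = opMatrix 0 T.closure T† 0 := by
  have hd := dense_opMatrix_adjoint hT hc
  rw [← adjoint_adjoint hd ((isSymm_opMatrix_adjoint hT hc).isClosable hd),
    adjoint_opMatrix_adjoint hT hc,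
    adjoint_opMatrix_offDiag (dense_closure_domain hT) (dense_adjoint_domain hT hc),
    adjoint_adjoint hT hc, adjoint_closure hT hc]

/-- The properties of the operator matrix `S = [[0, T], [T*, 0]]`. -/
theorem IsCounterexample.opMatrix (h : IsCounterexample T)
    {S : WithLp 2 (F × E) →ₗ.[ℂ] WithLp 2 (F × E)} (hS : S = UnboundedOp.opMatrix 0 T T† 0) :
    Dense (S.domain : Set (WithLp 2 (F × E))) ∧
      S† = UnboundedOp.opMatrix 0 T.closure T† 0 ∧
      IsSymm S ∧
      S.IsClosable ∧
      mul S S† = UnboundedOp.opMatrix (mul T T†) 0 0 (mul T† T.closure) ∧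
      mul S.closure S† = UnboundedOp.opMatrix (mul T.closure T†) 0 0 (mul T† T.closure) ∧
      Dense ((mul S S†).domain : Set (WithLp 2 (F × E))) ∧
      IsSelfAdjoint (mul T† T.closure) ∧
      (mul S S†)† = UnboundedOp.opMatrix (mul T T†)† 0 0 (mul T† T.closure) ∧
      (mul S S†)† ≠ mul S.closure S† := by
  subst hS
  have hd := dense_opMatrix_adjoint h.dense h.closable
  have hs := isSymm_opMatrix_adjoint h.dense h.closable
  have hsa := isSelfAdjoint_adjoint_mul_closure h.dense h.closable
  have h1 : mul (UnboundedOp.opMatrix 0 T T† 0) (UnboundedOp.opMatrix 0 T T† 0)† =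
      UnboundedOp.opMatrix (mul T T†) 0 0 (mul T† T.closure) := by
    rw [adjoint_opMatrix_adjoint h.dense h.closable, mul_opMatrix_offDiag]
  have h2 : mul (UnboundedOp.opMatrix 0 T T† 0).closure (UnboundedOp.opMatrix 0 T T† 0)† =
      UnboundedOp.opMatrix (mul T.closure T†) 0 0 (mul T† T.closure) := by
    rw [adjoint_opMatrix_adjoint h.dense h.closable, closure_opMatrix_adjoint h.dense h.closable,
      mul_opMatrix_offDiag]
  have h3 : (mul (UnboundedOp.opMatrix 0 T T† 0) (UnboundedOp.opMatrix 0 T T† 0)†)† =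
      UnboundedOp.opMatrix (mul T T†)† 0 0 (mul T† T.closure) := by
    rw [h1, adjoint_opMatrix_diag h.dense_mul hsa.dense_domain, LinearPMap.isSelfAdjoint_def.1 hsa]
  refine ⟨hd, adjoint_opMatrix_adjoint h.dense h.closable, hs, hs.isClosable hd, h1, h2, ?_, hsa,
    h3, ?_⟩
  · rw [h1]
    exact dense_opMatrix_diag_domain h.dense_mul hsa.dense_domain
  · rw [h3, h2]
    exact fun h4 => h.ne (opMatrix_diag_injective_left h4)

end Matrix

/-! ### The energy space embedding -/

section Energy

variable {H : Type*} [NormedAddCommGroup H] [InnerProductSpace ℂ H] {A : H →ₗ.[ℂ] H}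
  (hA : IsDensePositive A)

theorem mem_graph_energyEmbedding (u : EnergySpace A hA) (y : H) :
    (u, y) ∈ (energyEmbedding A hA).graph ↔
      ∃ x : A.domain, (EnergyRange.mk A hA x : EnergySpace A hA) = u ∧ A x = y := by
  rw [LinearPMap.mem_graph_iff]
  constructor
  · rintro ⟨⟨_, v, rfl⟩, rfl, rfl⟩
    obtain ⟨x, hx⟩ := v.2
    obtain rfl : EnergyRange.mk A hA x = v := Subtype.ext hx
    exact ⟨x, rfl, (energyEmbedding_apply x).symm⟩
  · rintro ⟨x, rfl, rfl⟩
    exact ⟨⟨_, coe_mem_energyEmbedding_domain _⟩, rfl, energyEmbedding_apply x⟩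

theorem dense_energyEmbedding_domain :
    Dense ((energyEmbedding A hA).domain : Set (EnergySpace A hA)) :=
  UniformSpace.Completion.denseRange_coe

theorem mem_graph_adjoint_energyEmbedding (y : H) (u : EnergySpace A hA) :
    (y, u) ∈ ((energyEmbedding A hA)†).graph ↔
      ∀ x : A.domain, inner ℂ (A x) y = inner ℂ (EnergyRange.mk A hA x : EnergySpace A hA) u := by
  rw [mem_graph_adjoint (dense_energyEmbedding_domain hA)]
  constructor
  · exact fun h x => h _ _ ((mem_graph_energyEmbedding hA _ _).2 ⟨x, rfl, rfl⟩)
  · intro h a b hab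
    obtain ⟨x, rfl, rfl⟩ := (mem_graph_energyEmbedding hA _ _).1 hab
    exact h x

theorem mk_mem_graph_adjoint_energyEmbedding (x : A.domain) :
    ((x : H), (EnergyRange.mk A hA x : EnergySpace A hA)) ∈ ((energyEmbedding A hA)†).graph := by
  rw [mem_graph_adjoint_energyEmbedding]
  intro z
  rw [UniformSpace.Completion.inner_coe, EnergyRange.inner_mk_mk]

theorem dense_adjoint_energyEmbedding_domain :
    Dense (((energyEmbedding A hA)†).domain : Set H) :=
  hA.dense.mono fun x hx =>
    LinearPMap.mem_domain_of_mem_graph (mk_mem_graph_adjoint_energyEmbedding hA ⟨x, hx⟩)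

variable [CompleteSpace H]

omit [CompleteSpace H] in
-- Symmetry of `A` gives `T* x = A x` on `D(A)`, hence `A ⊆ T T*`. Conversely, if `T* y` lies in
-- `ran A`, then `T* y = A x = T* x` for some `x`, and `T*` is injective because `ran A` is dense.
theorem energyEmbedding_mul_adjoint (hr : Dense (Set.range A)) :
    mul (energyEmbedding A hA) (energyEmbedding A hA)† = A := by
  refine LinearPMap.eq_of_eq_graph (SetLike.ext ?_)
  rintro ⟨y, z⟩
  rw [mem_graph_mul]
  constructor
  · rintro ⟨u, h1, h2⟩
    obtain ⟨x, rfl, rfl⟩ := (mem_graph_energyEmbedding hA _ _).1 h2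
    have hyx : y - x = 0 := by
      refine hr.eq_zero_of_inner_right ℂ ?_
      rintro _ ⟨v, rfl⟩
      rw [inner_sub_right, (mem_graph_adjoint_energyEmbedding hA _ _).1 h1 v,
        (mem_graph_adjoint_energyEmbedding hA _ _).1 (mk_mem_graph_adjoint_energyEmbedding hA x) v,
        sub_self]
    rw [sub_eq_zero.1 hyx]
    exact A.mem_graph x
  · intro h
    obtain ⟨x, hx, hz⟩ := (LinearPMap.mem_graph_iff _).1 h
    obtain rfl : (x : H) = y := hx
    obtain rfl : A x = z := hz
    exact ⟨_, mk_mem_graph_adjoint_energyEmbedding hA x,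
      (mem_graph_energyEmbedding hA _ _).2 ⟨x, rfl, rfl⟩⟩

theorem isCounterexample_energyEmbedding (hsa : ¬ IsSelfAdjoint A.closure)
    (hr : Dense (Set.range A)) : IsCounterexample (energyEmbedding A hA) := by
  have hd := dense_energyEmbedding_domain hA
  have hc := isClosable_of_dense_adjoint_domain hd (dense_adjoint_energyEmbedding_domain hA)
  refine ⟨hd, hc, ?_, ?_⟩
  · rw [energyEmbedding_mul_adjoint hA hr]
    exact hA.dense
  · rw [energyEmbedding_mul_adjoint hA hr]
    intro h
    have h1 : IsSelfAdjoint A† := h ▸ isSelfAdjoint_closure_mul_adjoint hd hc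
    have hAc := hA.symm.isClosable hA.dense
    rw [LinearPMap.isSelfAdjoint_def, adjoint_adjoint hA.dense hAc] at h1
    refine hsa ?_
    rw [LinearPMap.isSelfAdjoint_def, adjoint_closure hA.dense hAc, h1]

end Energy

/-! ### A positive operator that is not essentially self-adjoint -/

section Existence

variable {H : Type*} [NormedAddCommGroup H] [InnerProductSpace ℂ H] [CompleteSpace H]

omit [CompleteSpace H] in
-- By symmetry `C v` is orthogonal to `w^⊥`, so `C v = c w`. A nonzero `c` would put `w` in the
-- range, and `c = 0` gives `v = 0` by injectivity. This yields both density claims, applied to `C`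
-- and to `1 - C`.
theorem eq_zero_of_forall_inner_apply_eq_zero {C : H →ₗ[ℂ] H} (hC : C.IsSymmetric)
    (hinj : Function.Injective C) {w : H} (hw : ∀ x, C x ≠ w) {v : H}
    (hv : ∀ x, inner ℂ w x = 0 → inner ℂ (C x) v = 0) : v = 0 := by
  have h1 : C v ∈ (ℂ ∙ w)ᗮᗮ := by
    rw [Submodule.mem_orthogonal]
    intro x hx
    rw [← hC]
    exact hv x (Submodule.mem_orthogonal_singleton_iff_inner_right.1 hx)
  rw [Submodule.orthogonal_orthogonal, Submodule.mem_span_singleton] at h1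
  obtain ⟨c, hc⟩ := h1
  rcases eq_or_ne c 0 with rfl | hc0
  · rw [zero_smul] at hc
    exact hinj (by rw [← hc, map_zero])
  · exact absurd (by rw [map_smul, ← hc, inv_smul_smul₀ hc0]) (hw (c⁻¹ • v))

/-- For `0 ≤ C ≤ 1` such that `w` is in the range of neither `C` nor `1 - C`, the operator
`C x ↦ x - C x`, defined for `x` orthogonal to `w`, is positive, not essentially self-adjoint,
and has dense range. -/
theorem exists_isDensePositive_not_isSelfAdjoint {C : H →ₗ[ℂ] H} (hC : C.IsSymmetric)
    (hpos : ∀ x, 0 ≤ (inner ℂ (x - C x) (C x)).re) (hinj : Function.Injective C)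
    (hinj' : Function.Injective (1 - C : H →ₗ[ℂ] H)) {w : H} (hw : ∀ x, C x ≠ w)
    (hw' : ∀ x, (1 - C : H →ₗ[ℂ] H) x ≠ w) :
    ∃ A : H →ₗ.[ℂ] H, IsDensePositive A ∧ ¬ IsSelfAdjoint A.closure ∧ Dense (Set.range A) := by
  let g : Submodule ℂ (H × H) := (ℂ ∙ w)ᗮ.map (C.prod (1 - C))
  let A : H →ₗ.[ℂ] H := g.toLinearPMap
  have hg (a b : H) : (a, b) ∈ A.graph ↔ ∃ x, inner ℂ w x = 0 ∧ C x = a ∧ x - C x = b := by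
    have : A.graph = g := by
      refine Submodule.toLinearPMap_graph_eq g ?_
      rintro _ ⟨x, -, rfl⟩ hx
      obtain rfl : x = 0 := hinj (hx.trans (map_zero C).symm)
      exact map_zero (1 - C)
    rw [this, Submodule.mem_map]
    refine exists_congr fun x => and_congr Submodule.mem_orthogonal_singleton_iff_inner_right ?_
    exact Prod.ext_iff
  have hC' : (1 - C).IsSymmetric := LinearMap.IsSymmetric.one.sub hC
  have hd : Dense (A.domain : Set H) := dense_domain_of_graph fun v hv =>
    eq_zero_of_forall_inner_apply_eq_zero hC hinj hw fun x hx =>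
      hv _ _ ((hg _ _).2 ⟨x, hx, rfl, rfl⟩)
  have hA : IsDensePositive A := by
    refine ⟨hd, fun a b => ?_, fun a => ?_⟩
    · obtain ⟨x, -, hx, hx'⟩ := (hg _ _).1 (A.mem_graph a)
      obtain ⟨y, -, hy, hy'⟩ := (hg _ _).1 (A.mem_graph b)
      rw [← hx, ← hx', ← hy, ← hy', inner_sub_left, inner_sub_right, hC x y]
    · obtain ⟨x, -, hx, hx'⟩ := (hg _ _).1 (A.mem_graph a)
      rw [← hx, ← hx']
      exact hpos x
  refine ⟨A, hA, fun hsa => ?_, ?_⟩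
  · have hc := hA.symm.isClosable hd
    -- For `x ⊥ w`, `⟨x - C x, w⟩ = ⟨C x, -w⟩`: thus `A* w = -w`.
    have h1 : (w, -w) ∈ A†.graph := by
      rw [mem_graph_adjoint hd]
      intro a b hab
      obtain ⟨x, hx, rfl, rfl⟩ := (hg _ _).1 hab
      rw [inner_sub_left, inner_neg_right, inner_eq_zero_symm.1 hx, zero_sub]
    rw [← adjoint_closure hd hc, LinearPMap.isSelfAdjoint_def.1 hsa,
      ← hc.graph_closure_eq_closure_graph] at h1
    -- Positivity survives in the closed graph, which contains `(w, -w)` if `Ā` is self-adjoint;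
    -- then `-‖w‖² ≥ 0`.
    have hcl : IsClosed {p : H × H | 0 ≤ (inner ℂ p.2 p.1 : ℂ).re} :=
      isClosed_le (by fun_prop) (Complex.continuous_re.comp (by fun_prop))
    have h2 : (w, -w) ∈ {p : H × H | 0 ≤ (inner ℂ p.2 p.1 : ℂ).re} := by
      refine closure_minimal ?_ hcl h1
      rintro ⟨a, b⟩ hab
      obtain ⟨x, -, rfl, rfl⟩ := (hg _ _).1 hab
      exact hpos x
    have h3 : 0 ≤ (inner ℂ (-w) w : ℂ).re := h2
    rw [inner_neg_left, Complex.neg_re, neg_nonneg] at h3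
    have h4 : w = 0 := re_inner_self_nonpos (𝕜 := ℂ) |>.1 h3
    exact hw 0 (by rw [h4, map_zero])
  · have : Set.range A = (LinearMap.range A.toFun : Set H) := rfl
    rw [this, Submodule.dense_iff_topologicalClosure_eq_top, Submodule.topologicalClosure_eq_top_iff,
      Submodule.eq_bot_iff]
    intro v hv
    refine eq_zero_of_forall_inner_apply_eq_zero hC' hinj' hw' fun x hx => ?_
    refine (Submodule.mem_orthogonal _ _).1 hv _ ?_
    obtain ⟨y, -, hy⟩ := (LinearPMap.mem_graph_iff _).1 ((hg _ _).2 ⟨x, hx, rfl, rfl⟩)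
    exact ⟨y, hy⟩

end Existence

/-! ### The diagonal operator on `ℓ²` -/

section SequenceSpace

/-- The diagonal entries `1/2, 1 - 1/3, 1/4, 1 - 1/5, …`, which accumulate at `0` and `1`. -/
def diagEntry (n : ℕ) : ℝ := if Even n then 1 / (n + 2) else 1 - 1 / (n + 2)

theorem one_div_add_two_mem_Ioo (n : ℕ) : 1 / ((n : ℝ) + 2) ∈ Set.Ioo 0 1 :=
  ⟨by positivity, by rw [div_lt_one (by positivity)]; linarith [n.cast_nonneg (α := ℝ)]⟩

theorem diagEntry_mem_Ioo (n : ℕ) : diagEntry n ∈ Set.Ioo 0 1 := by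
  obtain ⟨h1, h2⟩ := one_div_add_two_mem_Ioo n
  unfold diagEntry
  split_ifs
  · exact ⟨h1, h2⟩
  · exact ⟨by linarith, by linarith⟩

theorem norm_diagEntry_smul_id_le (n : ℕ) :
    ‖(diagEntry n : ℂ) • ContinuousLinearMap.id ℂ ℂ‖ ≤ 1 := by
  obtain ⟨h1, h2⟩ := diagEntry_mem_Ioo n
  rw [norm_smul, ContinuousLinearMap.norm_id, mul_one, Complex.norm_real, Real.norm_of_nonneg h1.le]
  exact h2.le

/-- The multiplication by `diagEntry` on `ℓ²`. -/
def diagOp : lp (fun _ : ℕ => ℂ) 2 →L[ℂ] lp (fun _ : ℕ => ℂ) 2 :=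
  lp.mapCLM 2 (fun n => (diagEntry n : ℂ) • ContinuousLinearMap.id ℂ ℂ) zero_le_one
    norm_diagEntry_smul_id_le

theorem diagOp_apply (x : lp (fun _ : ℕ => ℂ) 2) (n : ℕ) : diagOp x n = diagEntry n * x n := rfl

/-- This is the vector `w`. It agrees with the diagonal of `C` at even indices and with that of `1 -
C` at odd ones, so a preimage under either would have infinitely many coordinates equal to `1`. -/
theorem memℓp_one_div_add_two : Memℓp (fun n : ℕ => ((1 / (n + 2) : ℝ) : ℂ)) 2 := by
  refine memℓp_gen ?_
  have := (summable_nat_add_iff 2).2 (Real.summable_one_div_nat_pow.2 one_lt_two)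
  refine this.congr fun n => ?_
  rw [Complex.norm_real, Real.norm_of_nonneg (one_div_add_two_mem_Ioo n).1.le]
  simp

theorem not_forall_apply_comp_eq_one (x : lp (fun _ : ℕ => ℂ) 2) {f : ℕ → ℕ}
    (hf : Function.Injective f) (h : ∀ n, x (f n) = 1) : False := by
  have h1 := ((lp.memℓp x).summable (by norm_num)).comp_injective hf
  have h2 := h1.tendsto_atTop_zero
  simp only [Function.comp_def, h, norm_one, Real.one_rpow] at h2
  exact one_ne_zero (tendsto_nhds_unique tendsto_const_nhds h2)

theorem exists_isDensePositive_lp :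
    ∃ A : lp (fun _ : ℕ => ℂ) 2 →ₗ.[ℂ] lp (fun _ : ℕ => ℂ) 2,
      IsDensePositive A ∧ ¬ IsSelfAdjoint A.closure ∧ Dense (Set.range A) := by
  have hne (n : ℕ) : (diagEntry n : ℂ) ≠ 0 := by
    exact_mod_cast (diagEntry_mem_Ioo n).1.ne'
  have hne' (n : ℕ) : 1 - (diagEntry n : ℂ) ≠ 0 := by
    exact_mod_cast (sub_pos.2 (diagEntry_mem_Ioo n).2).ne'
  have hsub (x : lp (fun _ : ℕ => ℂ) 2) (n : ℕ) :
      (1 - (diagOp : lp (fun _ : ℕ => ℂ) 2 →ₗ[ℂ] lp (fun _ : ℕ => ℂ) 2)) x n =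
        (1 - (diagEntry n : ℂ)) * x n := by
    rw [sub_mul, one_mul, ← diagOp_apply]
    rfl
  refine exists_isDensePositive_not_isSelfAdjoint
    (C := (diagOp : lp (fun _ : ℕ => ℂ) 2 →ₗ[ℂ] lp (fun _ : ℕ => ℂ) 2))
    (w := ⟨_, memℓp_one_div_add_two⟩) ?_ ?_ ?_ ?_ ?_ ?_
  · intro x y
    rw [lp.inner_eq_tsum, lp.inner_eq_tsum]
    refine tsum_congr fun n => ?_
    simp only [ContinuousLinearMap.coe_coe, diagOp_apply, RCLike.inner_apply, map_mul,
      Complex.conj_ofReal]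
    ring
  · intro x
    refine (Complex.hasSum_re (lp.hasSum_inner _ _)).nonneg fun n => ?_
    obtain ⟨h1, h2⟩ := diagEntry_mem_Ioo n
    -- Each term of the series is `d (1 - d) |x n|²`, with `0 < d < 1`.
    have : (inner ℂ ((x - diagOp x) n) (diagOp x n) : ℂ) =
        ((diagEntry n * (1 - diagEntry n) * Complex.normSq (x n) : ℝ) : ℂ) := by
      rw [lp.coeFn_sub, Pi.sub_apply, diagOp_apply, RCLike.inner_apply, Complex.ofReal_mul,
        Complex.normSq_eq_conj_mul_self]
      simp only [map_sub, map_mul, Complex.conj_ofReal]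
      push_cast
      ring
    refine (congrArg Complex.re this).ge.trans' ?_
    rw [Complex.ofReal_re]
    have := sub_pos.2 h2
    have := Complex.normSq_nonneg (x n)
    positivity
  · intro x y h
    refine lp.ext (funext fun n => mul_left_cancel₀ (hne n) ?_)
    exact congrArg (fun z : lp (fun _ : ℕ => ℂ) 2 => z n) h
  · intro x y h
    refine lp.ext (funext fun n => mul_left_cancel₀ (hne' n) ?_)
    rw [← hsub, ← hsub, h]
  · intro x h
    refine not_forall_apply_comp_eq_one x (f := fun n => 2 * n) (fun a b hab => by simpa using hab)
      fun n => ?_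
    have h1 : diagOp x (2 * n) = ((1 / ((2 * n : ℕ) + 2) : ℝ) : ℂ) :=
      congrArg (fun z : lp (fun _ : ℕ => ℂ) 2 => z (2 * n)) h
    refine mul_left_cancel₀ (hne (2 * n)) ?_
    rw [← diagOp_apply, h1, mul_one, diagEntry, if_pos (even_two_mul n)]
  · intro x h
    refine not_forall_apply_comp_eq_one x (f := fun n => 2 * n + 1) (fun a b hab => by simpa using hab)
      fun n => ?_
    have h1 : (1 - (diagEntry (2 * n + 1) : ℂ)) * x (2 * n + 1) =
        ((1 / ((2 * n + 1 : ℕ) + 2) : ℝ) : ℂ) := by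
      rw [← hsub, h]
    refine mul_left_cancel₀ (hne' (2 * n + 1)) ?_
    rw [h1, mul_one, diagEntry, if_neg (Nat.not_even_two_mul_add_one n)]
    push_cast
    ring

end SequenceSpace

end UnboundedOp

end

theorem mainTheorem4 :
    -- there is a densely defined symmetric `S` with `(S S*)* ≠ S̄ S*`
    (∃ (K : Type) (_ : NormedAddCommGroup K) (_ : InnerProductSpace ℂ K) (_ : CompleteSpace K)
      (S : K →ₗ.[ℂ] K),
      Dense (S.domain : Set K) ∧ UnboundedOp.IsSymm S ∧ S.IsClosable ∧
      Dense ((UnboundedOp.mul S S†).domain : Set K) ∧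
      (UnboundedOp.mul S S†)† ≠ UnboundedOp.mul S.closure S†) ∧
    -- every `T` with `(T T*)* ≠ T̄ T*` gives such an `S = [[0, T], [T*, 0]]`
    (∀ (E F : Type*) [NormedAddCommGroup E] [InnerProductSpace ℂ E] [CompleteSpace E]
      [NormedAddCommGroup F] [InnerProductSpace ℂ F] [CompleteSpace F] (T : E →ₗ.[ℂ] F),
      UnboundedOp.IsCounterexample T →
      ∀ S : WithLp 2 (F × E) →ₗ.[ℂ] WithLp 2 (F × E), S = UnboundedOp.opMatrix 0 T T† 0 →
      Dense (S.domain : Set (WithLp 2 (F × E))) ∧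
      S† = UnboundedOp.opMatrix 0 T.closure T† 0 ∧
      UnboundedOp.IsSymm S ∧
      S.IsClosable ∧
      UnboundedOp.mul S S† =
        UnboundedOp.opMatrix (UnboundedOp.mul T T†) 0 0 (UnboundedOp.mul T† T.closure) ∧
      UnboundedOp.mul S.closure S† =
        UnboundedOp.opMatrix (UnboundedOp.mul T.closure T†) 0 0
          (UnboundedOp.mul T† T.closure) ∧
      Dense ((UnboundedOp.mul S S†).domain : Set (WithLp 2 (F × E))) ∧
      IsSelfAdjoint (UnboundedOp.mul T† T.closure) ∧
      (UnboundedOp.mul S S†)† =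
        UnboundedOp.opMatrix (UnboundedOp.mul T T†)† 0 0 (UnboundedOp.mul T† T.closure) ∧
      (UnboundedOp.mul S S†)† ≠ UnboundedOp.mul S.closure S†) ∧
    -- such a `T` is the embedding `H_A ⊇ ran A → H` of a suitable positive operator `A`
    (∀ (H : Type*) [NormedAddCommGroup H] [InnerProductSpace ℂ H] [CompleteSpace H]
      (A : H →ₗ.[ℂ] H) (hA : UnboundedOp.IsDensePositive A),
      ¬ IsSelfAdjoint A.closure → Dense (Set.range A) →
      UnboundedOp.IsCounterexample (UnboundedOp.energyEmbedding A hA)) ∧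
    -- and such an `A` exists
    (∃ (H : Type) (_ : NormedAddCommGroup H) (_ : InnerProductSpace ℂ H) (_ : CompleteSpace H)
      (A : H →ₗ.[ℂ] H),
      UnboundedOp.IsDensePositive A ∧ ¬ IsSelfAdjoint A.closure ∧ Dense (Set.range A)) := by
  obtain ⟨A, hA, hsa, hr⟩ := UnboundedOp.exists_isDensePositive_lp
  refine ⟨?_, fun E F _ _ _ _ _ _ T hT S hS => hT.opMatrix hS,
    fun H _ _ _ A hA hsa hr => UnboundedOp.isCounterexample_energyEmbedding hA hsa hr,
    lp (fun _ : ℕ => ℂ) 2, inferInstance, inferInstance, inferInstance, A, hA, hsa, hr⟩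
  obtain ⟨hd, -, hs, hc, -, -, hm, -, -, hne⟩ :=
    (UnboundedOp.isCounterexample_energyEmbedding hA hsa hr).opMatrix rfl
  exact ⟨_, _, _, inferInstance, _, hd, hs, hc, hm, hne⟩
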